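/- All graphs are finite and simple. A graph is a unit interval graph if its vertices can be put in one-to-one correspondence with closed intervals of unit length in $\mathbb{R}$ so that two different vertices are adjacent if and only if their intervals intersect. A unit interval order of $G$ is an enumeration $v_1,\dots,v_n$ of $V(G)$ such that the closed neighborhood of every vertex consists of consecutive vertices. A graph is $2$-connected if it has at least three vertices, is connected, and remains connected after the deletion of any one vertex. A set $S\subseteq V(G)$ is $P_3$-convex if every vertex outside $S$ has at most one neighbor in $S$, and $R\subseteq V(G)$ is a ($P_3$-)hull set of $G$ if the smallest $P_3$-convex set containing $R$ is $V(G)$. For a hull set $R$ let $R_0=R$ and let $R_{i+1}$ be obtained from $R_i$ by adding all vertices with at least two neighbors in $R_i$; let $\tau_R(G)$ be the least $t$ with $R_t=V(G)$, and let $\tau(G)=\max\{\tau_R(G): R \text{ is a hull set of } G\}$ be the percolation time of $G$. Theorem. Let $G$ be a $2$-connected unit interval graph with $|V(G)|=n\ge 3$. Then there exists a $2$-connected unit interval graph $G^*$ such that any two distinct maximal cliques of $G^*$ with nonempty intersection have at least two common vertices, and $$\tau(G)=\tau(G^*)=\mathrm{diam}(G^*).$$ Moreover, for every unit interval order $v_1,\dots,v_n$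 of $G$, the sets $\{v_1,v_2\}$ and $\{v_{n-1},v_n\}$ are hull sets of $G$ and $$\tau(G)=\tau_{\{v_1,v_2\}}(G)=\tau_{\{v_{n-1},v_n\}}(G).$$ -/

import Mathlib

namespace P3Perc

variable {V : Type*}

/-- `G` is a unit interval graph: its vertices are in one-to-one correspondence with closed
intervals `[f v, f v + 1]` of the real line so that two different vertices are adjacent if and
only if their intervals intersect. -/
def IsUnitIntervalGraph (G : SimpleGraph V) : Prop :=
  ∃ f : V → ℝ, Function.Injective f ∧ ∀ u v : V, u ≠ v →
    (G.Adj u v ↔ (Set.Icc (f u) (f u + 1) ∩ Set.Icc (f v) (f v + 1)).Nonempty)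

/-- The enumeration `v 0, v 1, …, v (n - 1)` of the vertices of `G` is a unit interval order:
the closed neighborhood of each vertex consists of consecutive vertices. -/
def IsUnitIntervalOrder (G : SimpleGraph V) {n : ℕ} (v : Fin n ≃ V) : Prop :=
  ∀ i : Fin n, {j : Fin n | j = i ∨ G.Adj (v i) (v j)}.OrdConnected

/-- `G` is `2`-connected: it has at least three vertices, it is connected, and it remains
connected when any single vertex is deleted. -/
def IsTwoConnected [Fintype V] (G : SimpleGraph V) : Prop :=
  3 ≤ Fintype.card V ∧ G.Connected ∧ ∀ v : V, (G.induce ({v}ᶜ : Set V)).Connected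

/-- Any two distinct maximal cliques with nonempty intersection share at least two vertices. -/
def MaximalCliquesShareTwo (G : SimpleGraph V) : Prop :=
  ∀ C D : Set V, Maximal G.IsClique C → Maximal G.IsClique D → C ≠ D →
    (C ∩ D).Nonempty → 2 ≤ (C ∩ D).ncard

/-- `S` is `P₃`-convex: each vertex outside `S` has at most one neighbor in `S`. -/
def IsP3Convex (G : SimpleGraph V) (S : Set V) : Prop :=
  ∀ v, v ∉ S → (G.neighborSet v ∩ S).ncard ≤ 1

/-- The `P₃`-hull of `R`: the smallest `P₃`-convex set containing `R`. -/
def p3Hull (G : SimpleGraph V) (R : Set V) : Set V :=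
  ⋂₀ {S | IsP3Convex G S ∧ R ⊆ S}

/-- `R` is a `P₃`-hull set of `G` (`R` percolates `G`). -/
def IsHullSet (G : SimpleGraph V) (R : Set V) : Prop :=
  p3Hull G R = Set.univ

/-- One round of percolation: add all vertices with at least two neighbors in `S`. -/
def percStep (G : SimpleGraph V) (S : Set V) : Set V :=
  S ∪ {v | 2 ≤ (G.neighborSet v ∩ S).ncard}

/-- The set reached from `R` after `t` rounds of percolation. -/
def percSet (G : SimpleGraph V) (R : Set V) (t : ℕ) : Set V :=
  (percStep G)^[t] R

/-- `τ_R(G)`: the least number of rounds after which `R` has reached every vertex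
(only meaningful for hull sets `R`). -/
noncomputable def percTimeOf (G : SimpleGraph V) (R : Set V) : ℕ :=
  sInf {t | percSet G R t = Set.univ}

/-- The percolation time `τ(G)`: the maximum of `τ_R(G)` over all hull sets `R` of `G`. -/
noncomputable def percTime (G : SimpleGraph V) : ℕ :=
  sSup {t | ∃ R : Set V, IsHullSet G R ∧ percTimeOf G R = t}

/-- Being a hull set is the same as reaching all vertices after finitely many rounds. -/
theorem isHullSet_iff [Finite V] (G : SimpleGraph V) (R : Set V) :
    IsHullSet G R ↔ ∃ t, percSet G R t = Set.univ := by
  have hmono : Monotone (percSet G R) := by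
    refine monotone_nat_of_le_succ fun t => ?_
    rw [percSet, percSet, Function.iterate_succ_apply']
    exact Set.subset_union_left
  constructor
  · intro h
    obtain ⟨N, hN⟩ := WellFoundedGT.monotone_chain_condition
      (⟨percSet G R, hmono⟩ : ℕ →o Set V)
    refine ⟨N, ?_⟩
    have h1 : percSet G R N = percSet G R (N + 1) := hN (N + 1) (Nat.le_succ N)
    rw [percSet, percSet, Function.iterate_succ_apply'] at h1
    refine Set.eq_univ_of_univ_subset ?_
    rw [← h]
    refine Set.sInter_subset_of_mem ⟨fun v hv => ?_, hmono (Nat.zero_le N)⟩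
    by_contra hc
    apply hv
    rw [percSet, h1]
    exact Or.inr (Nat.lt_of_not_le hc)
  · rintro ⟨t, ht⟩
    refine Set.eq_univ_of_univ_subset ?_
    rw [← ht]
    refine Set.subset_sInter fun S hS => ?_
    clear ht
    induction t with
    | zero => exact hS.2
    | succ k ih =>
      rw [percSet, Function.iterate_succ_apply']
      rintro v (hv | hv)
      · exact ih hv
      · by_contra hc
        have h1 := hS.1 v hc
        have h2 : (G.neighborSet v ∩ percSet G R k).ncard ≤ (G.neighborSet v ∩ S).ncard :=
          Set.ncard_le_ncard (Set.inter_subset_inter_right _ ih) (Set.toFinite _)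
        have h3 : 2 ≤ (G.neighborSet v ∩ percSet G R k).ncard := hv
        omega

/-- The supremum that defines the percolation time of a finite graph is a maximum. -/
theorem percTime_isGreatest [Finite V] (G : SimpleGraph V) :
    IsGreatest {t | ∃ R : Set V, IsHullSet G R ∧ percTimeOf G R = t} (percTime G) := by
  have hne : {t | ∃ R : Set V, IsHullSet G R ∧ percTimeOf G R = t}.Nonempty :=
    ⟨_, Set.univ, (isHullSet_iff G _).2 ⟨0, rfl⟩, rfl⟩
  have hfin : {t | ∃ R : Set V, IsHullSet G R ∧ percTimeOf G R = t}.Finite :=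
    Set.Finite.subset (Set.finite_range (percTimeOf G)) (by rintro t ⟨R, -, rfl⟩; exact ⟨R, rfl⟩)
  exact ⟨Nat.sSup_mem hne hfin.bddAbove, fun t ht => le_csSup hfin.bddAbove ht⟩

end P3Perc

/-!
In a unit interval order an edge `v a, v b` makes all vertices between `v a` and `v b` pairwise
adjacent. Consequently the percolation of `{v 0, v 1}` fills an initial segment at each time, and
`2`-connectedness, which makes vertices at distance two in the order adjacent, keeps that segment
growing.

A hull set `S ≠ V(G)` contains two neighbors `v a`, `v b`, with `a < b`, of a common vertex. To the
right of `v a`, the percolation of `S` is not slower than that of `{v 0, v 1}`: after one round if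
`v a` and `v b` are adjacent, and after two rounds otherwise, `S` has caught up there, and it stays
ahead from then on. Symmetrically, to the left of `v b` the percolation of `S` is not slower than
that of the last two vertices. Finally, the first two and the last two vertices take equally long,
so this common time is `τ(G)`.

For `G*` one can take the strong product of an edge with a path of length `τ(G)`: in its natural
order, each round of percolation from the first two vertices fills one more fibre, and the diameter
is the length of the path.
-/

namespace P3Perc

section Percolation

variable {V : Type*} {G : SimpleGraph V} {R : Set V} {t : ℕ}

lemma percTimeOf_le (h : percSet G R t = Set.univ) : percTimeOf G R ≤ t :=
  Nat.sInf_le h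

variable [Finite V]

lemma mem_percSet_succ {z : V} :
    z ∈ percSet G R (t + 1) ↔
      z ∈ percSet G R t ∨ (G.neighborSet z ∩ percSet G R t).Nontrivial := by
  rw [percSet, Function.iterate_succ_apply', ← Set.one_lt_ncard_iff_nontrivial]
  rfl

lemma monotone_percSet (G : SimpleGraph V) (R : Set V) : Monotone (percSet G R) :=
  monotone_nat_of_le_succ fun _ _ hz => mem_percSet_succ.2 (Or.inl hz)

lemma IsHullSet.percSet_percTimeOf (h : IsHullSet G R) :
    percSet G R (percTimeOf G R) = Set.univ :=
  Nat.sInf_mem (s := {t | percSet G R t = Set.univ}) ((isHullSet_iff G R).1 h)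

lemma IsHullSet.percTimeOf_le_percTime (h : IsHullSet G R) : percTimeOf G R ≤ percTime G :=
  (percTime_isGreatest G).2 ⟨R, h, rfl⟩

lemma percTime_le {T : ℕ} (h : ∀ R, IsHullSet G R → percTimeOf G R ≤ T) : percTime G ≤ T := by
  obtain ⟨R, hR, hRT⟩ := (percTime_isGreatest G).1
  exact hRT ▸ h R hR

lemma IsHullSet.exists_nontrivial_neighborSet_inter (h : IsHullSet G R) (hR : R ≠ Set.univ) :
    ∃ z, (G.neighborSet z ∩ R).Nontrivial := by
  by_contra! hsub
  have hconv : IsP3Convex G R := fun z _ => not_lt.1 fun hz =>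
    Set.not_nontrivial_iff.2 (hsub z) (Set.one_lt_ncard_iff_nontrivial.1 hz)
  exact hR (Set.eq_univ_of_univ_subset (h ▸ Set.sInter_subset_of_mem ⟨hconv, subset_rfl⟩))

lemma isHullSet_compl_singleton {x : V} (hx : (G.neighborSet x).Nontrivial) :
    IsHullSet G {x}ᶜ := by
  refine (isHullSet_iff G _).2 ⟨1, Set.eq_univ_of_forall fun u => mem_percSet_succ.2 ?_⟩
  by_cases hu : u = x
  · subst hu
    have hsub : G.neighborSet u ⊆ {u}ᶜ := fun y hy => G.ne_of_adj hy.symm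
    exact Or.inr ((Set.inter_eq_left.2 hsub).symm ▸ hx)
  · exact Or.inl hu

lemma one_le_percTime {x : V} (hx : (G.neighborSet x).Nontrivial) : 1 ≤ percTime G := by
  have hull := isHullSet_compl_singleton hx
  refine le_trans (Nat.one_le_iff_ne_zero.2 fun h0 => ?_) hull.percTimeOf_le_percTime
  have hxmem : x ∈ percSet G {x}ᶜ 0 := h0 ▸ hull.percSet_percTimeOf ▸ Set.mem_univ x
  exact hxmem rfl

lemma exists_nontrivial_neighborSet (hG : G.Connected) (hV : 2 < Nat.card V) :
    ∃ x, (G.neighborSet x).Nontrivial := by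
  have : Nontrivial V := Finite.one_lt_card_iff_nontrivial.1 (by omega)
  obtain ⟨x⟩ := hG.nonempty
  obtain ⟨y, hxy⟩ := hG.preconnected.exists_adj_of_nontrivial x
  obtain ⟨w, hw⟩ : ∃ w, w ∉ ({x, y} : Set V) := by
    by_contra! hall
    have hcard : ({x, y} : Set V).ncard ≤ 2 := Set.ncard_insert_le x {y} |>.trans (by simp)
    rw [Set.eq_univ_of_forall hall, Set.ncard_univ] at hcard
    omega
  obtain ⟨p⟩ := hG.preconnected x w
  obtain ⟨d, -, hfst, hsnd⟩ := p.exists_boundary_dart {x, y} (Set.mem_insert x {y}) hw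
  rcases hfst with hfst | hfst
  · exact ⟨x, y, hxy, d.snd, hfst ▸ d.adj, fun h => hsnd (Or.inr h.symm)⟩
  · exact ⟨y, x, hxy.symm, d.snd, hfst ▸ d.adj, fun h => hsnd (Or.inl h.symm)⟩

end Percolation

section UnitIntervalOrder

variable {V : Type*} {G : SimpleGraph V} {n : ℕ} {v : Fin n ≃ V}

lemma nontrivial_iff_exists_apply_lt {ι : Type*} [LinearOrder ι] (e : ι ≃ V) {s : Set V} :
    s.Nontrivial ↔ ∃ i j, i < j ∧ e i ∈ s ∧ e j ∈ s := by
  constructor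
  · intro hs
    obtain ⟨i, hi, j, hj, hij⟩ := (hs.preimage e.surjective).exists_lt
    exact ⟨i, j, hij, hi, hj⟩
  · rintro ⟨i, j, hij, hi, hj⟩
    exact ⟨e i, hi, e j, hj, e.injective.ne hij.ne⟩

lemma IsUnitIntervalOrder.adj_of_le (hv : IsUnitIntervalOrder G v) {a i j b : Fin n}
    (hai : a ≤ i) (hij : i < j) (hjb : j ≤ b) (hab : G.Adj (v a) (v b)) :
    G.Adj (v i) (v j) := by
  have hib : G.Adj (v i) (v b) :=
    (((hv b).out (Or.inr hab.symm) (Or.inl rfl) ⟨hai, hij.le.trans hjb⟩).resolve_left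
      (hij.trans_le hjb).ne).symm
  exact ((hv i).out (Or.inl rfl) (Or.inr hib) ⟨hij.le, hjb⟩).resolve_left hij.ne'

lemma IsUnitIntervalOrder.rev (hv : IsUnitIntervalOrder G v) :
    IsUnitIntervalOrder G (Fin.revPerm.trans v) := by
  intro i
  refine ⟨fun a ha b hb c hc => ?_⟩
  have hmem : ∀ j : Fin n, (j = i ∨ G.Adj ((Fin.revPerm.trans v) i) ((Fin.revPerm.trans v) j)) ↔
      j.rev ∈ {j : Fin n | j = i.rev ∨ G.Adj (v i.rev) (v j)} := by simp
  exact (hmem c).2 ((hv i.rev).out ((hmem b).1 hb) ((hmem a).1 ha)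
    ⟨Fin.rev_le_rev.2 hc.2, Fin.rev_le_rev.2 hc.1⟩)

/-- The set of the first two vertices in the enumeration `v` (all vertices if there are fewer).
The last two are encoded as the first two of the reversed enumeration `Fin.revPerm.trans v`. -/
def firstTwo (v : Fin n ≃ V) : Set V := {x | (v.symm x : ℕ) ≤ 1}

lemma apply_mem_firstTwo {i : Fin n} : v i ∈ firstTwo v ↔ (i : ℕ) ≤ 1 := by
  simp [firstTwo]

lemma apply_mem_firstTwo_rev {i : Fin n} :
    v i ∈ firstTwo (Fin.revPerm.trans v) ↔ n ≤ i + 2 := by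
  simp only [firstTwo, Set.mem_ofPred_eq, Equiv.symm_trans_apply, Equiv.symm_apply_apply,
    Fin.revPerm_symm, Fin.revPerm_apply, Fin.val_rev]
  omega

lemma firstTwo_eq_pair (v : Fin n ≃ V) (hn : 1 < n) :
    firstTwo v = {v ⟨0, by omega⟩, v ⟨1, hn⟩} := by
  refine Set.ext (v.surjective.forall.2 fun i => ?_)
  rw [apply_mem_firstTwo]
  simp only [Set.mem_insert_iff, Set.mem_singleton_iff, EmbeddingLike.apply_eq_iff_eq, Fin.ext_iff]
  omega

lemma firstTwo_rev_eq_pair (v : Fin n ≃ V) (hn : 1 < n) :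
    firstTwo (Fin.revPerm.trans v) = {v ⟨n - 2, by omega⟩, v ⟨n - 1, by omega⟩} := by
  refine Set.ext (v.surjective.forall.2 fun i => ?_)
  rw [apply_mem_firstTwo_rev]
  simp only [Set.mem_insert_iff, Set.mem_singleton_iff, EmbeddingLike.apply_eq_iff_eq, Fin.ext_iff]
  omega

variable [Finite V] {S : Set V} {s t T : ℕ}

lemma apply_mem_percSet_succ (v : Fin n ≃ V) {i : Fin n} :
    v i ∈ percSet G S (t + 1) ↔ v i ∈ percSet G S t ∨ ∃ j k, j < k ∧
      (G.Adj (v i) (v j) ∧ v j ∈ percSet G S t) ∧ G.Adj (v i) (v k) ∧ v k ∈ percSet G S t := by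
  rw [mem_percSet_succ, nontrivial_iff_exists_apply_lt v]
  rfl

lemma apply_mem_percSet_firstTwo_of_le_one {i : Fin n} (hi : (i : ℕ) ≤ 1) (t : ℕ) :
    v i ∈ percSet G (firstTwo v) t :=
  monotone_percSet G _ (Nat.zero_le t) (apply_mem_firstTwo.2 hi)

namespace IsUnitIntervalOrder

lemma isLowerSet_percSet_firstTwo (hv : IsUnitIntervalOrder G v) (t : ℕ) :
    IsLowerSet (v ⁻¹' percSet G (firstTwo v) t) := by
  induction t with
  | zero => exact fun i j hji hi => apply_mem_firstTwo.2 (le_trans hji (apply_mem_firstTwo.1 hi))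
  | succ t ih =>
    intro i j hji hi
    rcases (apply_mem_percSet_succ v).1 hi with hi | ⟨x, y, hxy, ⟨hix, hx⟩, hiy, hy⟩
    · exact (apply_mem_percSet_succ v).2 (Or.inl (ih hji hi))
    by_cases hj : v j ∈ percSet G (firstTwo v) t
    · exact (apply_mem_percSet_succ v).2 (Or.inl hj)
    have hyj : y < j := not_le.1 fun hjy => hj (ih hjy hy)
    exact (apply_mem_percSet_succ v).2 (Or.inr ⟨x, y, hxy,
      ⟨(hv.adj_of_le le_rfl (hxy.trans hyj) hji hix.symm).symm, hx⟩,
      (hv.adj_of_le le_rfl hyj hji hiy.symm).symm, hy⟩)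

lemma exists_lt_of_mem_percSet_firstTwo_succ (hv : IsUnitIntervalOrder G v) {i : Fin n}
    (hi : v i ∈ percSet G (firstTwo v) (t + 1)) (hi' : v i ∉ percSet G (firstTwo v) t) :
    ∃ j k, j < k ∧ k < i ∧ v k ∈ percSet G (firstTwo v) t ∧ G.Adj (v j) (v i) := by
  obtain ⟨j, k, hjk, ⟨hij, -⟩, -, hk⟩ := ((apply_mem_percSet_succ v).1 hi).resolve_left hi'
  exact ⟨j, k, hjk, not_le.1 fun hik => hi' (hv.isLowerSet_percSet_firstTwo t hik hk), hk,
    hij.symm⟩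

lemma adj_of_mem_percSet_firstTwo_one (hv : IsUnitIntervalOrder G v) {i j : Fin n} (hij : i < j)
    (hj : 1 < (j : ℕ)) (hjmem : v j ∈ percSet G (firstTwo v) 1) : G.Adj (v i) (v j) := by
  obtain ⟨x, y, hxy, -, hy, hxj⟩ := hv.exists_lt_of_mem_percSet_firstTwo_succ (t := 0) hjmem
    (fun h => (apply_mem_firstTwo.1 h).not_gt hj)
  have hy1 : (y : ℕ) ≤ 1 := apply_mem_firstTwo.1 hy
  exact hv.adj_of_le (by lia) hij le_rfl hxj

lemma mem_percSet_firstTwo_of_le_add_one (hv : IsUnitIntervalOrder G v)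
    (hadj : ∀ i j : Fin n, (j : ℕ) = i + 2 → G.Adj (v i) (v j)) (t : ℕ) {i : Fin n}
    (hi : (i : ℕ) ≤ t + 1) : v i ∈ percSet G (firstTwo v) t := by
  induction t generalizing i with
  | zero => exact apply_mem_firstTwo.2 hi
  | succ t ih =>
    rcases hi.lt_or_eq with hlt | heq
    · exact monotone_percSet G _ t.le_succ (ih (by omega))
    have hji := hadj ⟨t, by omega⟩ i heq
    have hki := hv.adj_of_le (i := ⟨t + 1, by omega⟩) (by simp) (by simp [Fin.lt_def, heq])
      le_rfl hji
    exact (apply_mem_percSet_succ v).2 (Or.inr ⟨_, _, by simp, ⟨hji.symm, ih (by simp)⟩,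
      hki.symm, ih le_rfl⟩)

lemma isHullSet_firstTwo (hv : IsUnitIntervalOrder G v)
    (hadj : ∀ i j : Fin n, (j : ℕ) = i + 2 → G.Adj (v i) (v j)) : IsHullSet G (firstTwo v) :=
  (isHullSet_iff G _).2 ⟨n, Set.eq_univ_of_forall (v.surjective.forall.2 fun i =>
    hv.mem_percSet_firstTwo_of_le_add_one hadj n (by omega))⟩

/-- If two vertices were reached both from the left in `j` rounds and from the right in `k` rounds,
then the left percolation could retrace the rounds of the right one backwards and would be complete
after `s = j + k` rounds. -/
lemma le_of_mem_percSet_firstTwo_of_mem_rev (hv : IsUnitIntervalOrder G v)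
    (hs : percSet G (firstTwo v) s ≠ Set.univ) {j k : ℕ} (hjk : j + k = s) {m i : Fin n}
    (hm : v m ∈ percSet G (firstTwo v) j)
    (hi : v i ∈ percSet G (firstTwo (Fin.revPerm.trans v)) k) : m ≤ i := by
  have hlower := hv.isLowerSet_percSet_firstTwo
  by_contra! him
  induction k generalizing m i j with
  | zero =>
    have hin : n ≤ i + 2 := apply_mem_firstTwo_rev.1 hi
    refine hs (Set.eq_univ_of_forall (v.surjective.forall.2 fun l => ?_))
    exact hlower s (show l ≤ m by lia) (by rwa [← hjk])
  | succ k ih =>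
    have hmono := monotone_percSet G (firstTwo v) j.le_succ
    rcases (apply_mem_percSet_succ v).1 hi with hi | ⟨x, y, hxy, ⟨-, hx⟩, hiy, -⟩
    · exact ih (by omega) (hmono hm) hi him
    have hmx : m ≤ x := not_lt.1 (ih (j := j + 1) (by omega) (hmono hm) hx)
    have hmy : G.Adj (v m) (v y) := hv.adj_of_le him.le (hmx.trans_lt hxy) le_rfl hiy
    have hy : v y ∈ percSet G (firstTwo v) (j + 1) := (apply_mem_percSet_succ v).2
      (Or.inr ⟨i, m, him, ⟨hiy.symm, hlower j him.le hm⟩, hmy.symm, hm⟩)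
    exact ih (by omega) hy hx hxy

lemma percSet_firstTwo_eq_univ_of_rev (hv : IsUnitIntervalOrder G v)
    (ht : percSet G (firstTwo (Fin.revPerm.trans v)) t = Set.univ) :
    percSet G (firstTwo v) t = Set.univ := by
  by_contra hne
  obtain ⟨x, hx⟩ := (Set.ne_univ_iff_exists_notMem _).1 hne
  obtain ⟨i, rfl⟩ := v.surjective x
  have hi : 1 < (i : ℕ) := not_le.1 fun hi => hx (apply_mem_percSet_firstTwo_of_le_one hi t)
  have hle := hv.le_of_mem_percSet_firstTwo_of_mem_rev hne (Nat.zero_add t)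
    (m := ⟨1, by omega⟩) (i := ⟨0, by omega⟩) (apply_mem_firstTwo.2 le_rfl) (ht ▸ Set.mem_univ _)
  simp at hle

lemma percSet_firstTwo_rev_eq_univ_iff (hv : IsUnitIntervalOrder G v) :
    percSet G (firstTwo (Fin.revPerm.trans v)) t = Set.univ ↔
      percSet G (firstTwo v) t = Set.univ := by
  have hrev : Fin.revPerm.trans (Fin.revPerm.trans v) = v := by ext; simp
  exact ⟨hv.percSet_firstTwo_eq_univ_of_rev,
    fun h => hv.rev.percSet_firstTwo_eq_univ_of_rev (hrev.symm ▸ h)⟩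

lemma mem_percSet_succ_of_edge (hv : IsUnitIntervalOrder G v) {a b i : Fin n} (hab : a < b)
    (hadj : G.Adj (v a) (v b)) (ha : v a ∈ percSet G S t) (hb : v b ∈ percSet G S t)
    (hai : a ≤ i) (hi : i ≤ b ∨ G.Adj (v a) (v i)) : v i ∈ percSet G S (t + 1) := by
  rcases eq_or_ne i a with rfl | hia
  · exact monotone_percSet G S t.le_succ ha
  rcases eq_or_ne i b with rfl | hib
  · exact monotone_percSet G S t.le_succ hb
  have hai : a < i := lt_of_le_of_ne hai hia.symm
  refine (apply_mem_percSet_succ v).2 (Or.inr ⟨a, b, hab, ⟨?_, ha⟩, ?_, hb⟩)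
  · exact hi.elim (fun h => (hv.adj_of_le le_rfl hai h hadj).symm) fun h => h.symm
  · rcases lt_or_gt_of_ne hib with hlt | hgt
    · exact hv.adj_of_le hai.le hlt le_rfl hadj
    · exact (hv.adj_of_le hab.le hgt le_rfl (hi.resolve_left hgt.not_ge)).symm

end IsUnitIntervalOrder

/-- From `v a` onwards, the percolation of `S` is ahead of the percolation of the first two vertices
of `v` after `t` rounds, and it has reached `v a` and `v (a + 1)`. -/
def Dominates (G : SimpleGraph V) (v : Fin n ≃ V) (S : Set V) (a : Fin n) (t : ℕ) : Prop :=
  ∀ i : Fin n, a ≤ i → (i : ℕ) ≤ a + 1 ∨ v i ∈ percSet G (firstTwo v) t → v i ∈ percSet G S t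

namespace Dominates

variable {a : Fin n}

lemma succ (h : Dominates G v S a t) (hv : IsUnitIntervalOrder G v) :
    Dominates G v S a (t + 1) := by
  intro i hai hi
  by_cases hmem : (i : ℕ) ≤ a + 1 ∨ v i ∈ percSet G (firstTwo v) t
  · exact monotone_percSet G S t.le_succ (h i hai hmem)
  obtain ⟨hia, hit⟩ := not_or.1 hmem
  obtain ⟨x, y, hxy, hyi, hy, hxi⟩ :=
    hv.exists_lt_of_mem_percSet_firstTwo_succ (hi.resolve_left hia) hit
  have hx : v x ∈ percSet G (firstTwo v) t := hv.isLowerSet_percSet_firstTwo t hxy.le hy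
  set b : Fin n := ⟨a + 1, by omega⟩
  -- `x` and `y` may lie to the left of `a`, where nothing is known about `S`.
  have hmax {j c : Fin n} (hj : v j ∈ percSet G (firstTwo v) t) (hac : a ≤ c)
      (hca : (c : ℕ) ≤ a + 1) : v (max j c) ∈ percSet G S t := by
    refine h _ (hac.trans (le_max_right j c)) ?_
    rcases max_choice j c with heq | heq <;> rw [heq]
    exacts [Or.inr hj, Or.inl hca]
  have hab : a < b := by simp [b, Fin.lt_def]
  have hlt : max x a < max y b := max_lt_max hxy hab
  have hyb : max y b < i := max_lt hyi (by simp only [b, Fin.lt_def]; omega)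
  refine (apply_mem_percSet_succ v).2 (Or.inr ⟨max x a, max y b, hlt,
    ⟨?_, hmax hx le_rfl (by omega)⟩, ?_, hmax hy hab.le le_rfl⟩)
  · exact (hv.adj_of_le (le_max_left x a) (hlt.trans hyb) le_rfl hxi).symm
  · exact (hv.adj_of_le ((le_max_left x a).trans hlt.le) hyb le_rfl hxi).symm

lemma mono (h : Dominates G v S a t) (hv : IsUnitIntervalOrder G v) (htT : t ≤ T) :
    Dominates G v S a T := by
  induction T, htT using Nat.le_induction with
  | base => exact h
  | succ T _ ih => exact ih.succ hv

end Dominates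

namespace IsUnitIntervalOrder

variable {a b c : Fin n}

lemma dominates_one (hv : IsUnitIntervalOrder G v) (hab : a < b) (ha : v a ∈ S) (hb : v b ∈ S)
    (hadj : G.Adj (v a) (v b)) : Dominates G v S a 1 := by
  intro i hai hi
  refine hv.mem_percSet_succ_of_edge (t := 0) hab hadj ha hb hai ?_
  by_cases hib : i ≤ b
  · exact Or.inl hib
  · have hi1 : v i ∈ percSet G (firstTwo v) 1 := hi.resolve_left (by lia)
    exact Or.inr (hv.adj_of_mem_percSet_firstTwo_one (by lia) (by lia) hi1)

/-- Let `v d` be the last neighbor of `v a`. It enters in the first round, as it is adjacent to both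
`v a` and `v b`, so that the edges `v a, v d` and `v d, v b` drive the second round. -/
lemma dominates_two (hv : IsUnitIntervalOrder G v) (hac : a < c) (hcb : c < b)
    (ha : v a ∈ S) (hb : v b ∈ S) (hadj : ¬ G.Adj (v a) (v b)) (hca : G.Adj (v c) (v a))
    (hcb' : G.Adj (v c) (v b)) : Dominates G v S a 2 := by
  obtain ⟨d, had, hlast⟩ : ∃ d, G.Adj (v a) (v d) ∧ ∀ j, G.Adj (v a) (v j) → j ≤ d :=
    Set.exists_max_image {j | G.Adj (v a) (v j)} id (Set.toFinite _) ⟨c, hca.symm⟩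
  have hcd : c ≤ d := hlast c hca.symm
  have hdb : d < b := not_le.1 fun hbd =>
    hadj (hv.adj_of_le le_rfl (hac.trans hcb) hbd had)
  have hdb' : G.Adj (v d) (v b) := hv.adj_of_le hcd hdb le_rfl hcb'
  have hmono := monotone_percSet G S zero_le_one
  have hd : v d ∈ percSet G S 1 := (apply_mem_percSet_succ v).2
    (Or.inr ⟨a, b, hac.trans hcb, ⟨had.symm, ha⟩, hdb', hb⟩)
  intro i hai hi
  by_cases hid : i ≤ d
  · exact hv.mem_percSet_succ_of_edge (hac.trans_le hcd) had (hmono ha) hd hai (Or.inl hid)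
  have hdi : d < i := not_le.1 hid
  refine hv.mem_percSet_succ_of_edge hdb hdb' hd (hmono hb) hdi.le
    (or_iff_not_imp_left.2 fun hib => ?_)
  have hnot : v i ∉ percSet G (firstTwo v) 1 := fun h =>
    hid (hlast i (hv.adj_of_mem_percSet_firstTwo_one (by lia) (by lia) h))
  obtain ⟨x, y, hxy, -, hy, hxi⟩ :=
    hv.exists_lt_of_mem_percSet_firstTwo_succ (hi.resolve_left (by lia)) hnot
  have hyd : y ≤ d := not_lt.1 fun hdy =>
    hdy.not_ge (hlast y (hv.adj_of_mem_percSet_firstTwo_one (by lia) (by lia) hy))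
  exact hv.adj_of_le (hxy.le.trans hyd) hdi le_rfl hxi

lemma mem_percSet_of_percSet_firstTwo_eq_univ (hv : IsUnitIntervalOrder G v) (hab : a < b)
    (ha : v a ∈ S) (hb : v b ∈ S) (hca : G.Adj (v c) (v a)) (hcb : G.Adj (v c) (v b))
    (hT : percSet G (firstTwo v) T = Set.univ) {i : Fin n} (hai : a ≤ i) :
    v i ∈ percSet G S T := by
  suffices h : Dominates G v S a T from h i hai (Or.inr (hT ▸ Set.mem_univ _))
  have hne_a : c ≠ a := fun h => hca.ne (congrArg v h)
  have hne_b : c ≠ b := fun h => hcb.ne (congrArg v h)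
  by_cases hadj : G.Adj (v a) (v b)
  · refine (hv.dominates_one hab ha hb hadj).mono hv (Nat.one_le_iff_ne_zero.2 fun hT0 => ?_)
    have hle (j : Fin n) : (j : ℕ) ≤ 1 :=
      apply_mem_firstTwo.1 (show v j ∈ percSet G (firstTwo v) 0 from hT0 ▸ hT ▸ Set.mem_univ _)
    have := hle a
    have := hle b
    have := hle c
    lia
  have hac : a < c := lt_of_le_of_ne
    (not_lt.1 fun h => hadj (hv.adj_of_le h.le hab le_rfl hcb)) hne_a.symm
  have hcb_lt : c < b := lt_of_le_of_ne
    (not_lt.1 fun h => hadj (hv.adj_of_le le_rfl hab h.le hca.symm)) hne_b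
  refine (hv.dominates_two hac hcb_lt ha hb hadj hca hcb).mono hv (not_lt.1 fun hT2 => ?_)
  have hb1 : v b ∈ percSet G (firstTwo v) 1 :=
    monotone_percSet G _ (Nat.le_of_lt_succ hT2) (hT ▸ Set.mem_univ _)
  exact hadj (hv.adj_of_mem_percSet_firstTwo_one hab (by lia) hb1)

theorem percTimeOf_firstTwo (hv : IsUnitIntervalOrder G v) (h : IsHullSet G (firstTwo v)) :
    percTimeOf G (firstTwo v) = percTime G := by
  have hT := h.percSet_percTimeOf
  refine le_antisymm h.percTimeOf_le_percTime (percTime_le fun S hS => percTimeOf_le ?_)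
  rcases eq_or_ne S Set.univ with rfl | hne
  · exact Set.eq_univ_of_univ_subset (monotone_percSet G _ (Nat.zero_le _))
  obtain ⟨z, hz⟩ := hS.exists_nontrivial_neighborSet_inter hne
  obtain ⟨c, rfl⟩ := v.surjective z
  obtain ⟨a, b, hab, ⟨hca, ha⟩, hcb, hb⟩ := (nontrivial_iff_exists_apply_lt v).1 hz
  refine Set.eq_univ_of_forall (v.surjective.forall.2 fun i => ?_)
  rcases le_total a i with hai | hia
  · exact hv.mem_percSet_of_percSet_firstTwo_eq_univ hab ha hb hca hcb hT hai
  · have hrev := hv.rev.mem_percSet_of_percSet_firstTwo_eq_univ (S := S) (c := c.rev)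
      (Fin.rev_lt_rev.2 hab) (by simpa using hb) (by simpa using ha) (by simpa using hcb)
      (by simpa using hca) (hv.percSet_firstTwo_rev_eq_univ_iff.2 hT)
      (Fin.rev_le_rev.2 (hia.trans hab.le))
    simpa using hrev

lemma isHullSet_firstTwo_rev (hv : IsUnitIntervalOrder G v) (h : IsHullSet G (firstTwo v)) :
    IsHullSet G (firstTwo (Fin.revPerm.trans v)) :=
  (isHullSet_iff G _).2 ⟨_, hv.percSet_firstTwo_rev_eq_univ_iff.2 h.percSet_percTimeOf⟩

end IsUnitIntervalOrder
end UnitIntervalOrder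

section TwoConnected

variable {V : Type*} {G : SimpleGraph V} {n : ℕ} {v : Fin n ≃ V}

lemma IsUnitIntervalOrder.adj_of_preconnected_induce (hv : IsUnitIntervalOrder G v)
    (hG : ∀ x : V, (G.induce ({x}ᶜ : Set V)).Preconnected) {i k : Fin n} (hik : (k : ℕ) = i + 2) :
    G.Adj (v i) (v k) := by
  set j : Fin n := ⟨i + 1, by omega⟩ with hj
  have hij : i < j := by simp [hj, Fin.lt_def]
  have hjk : j < k := by simp [hj, Fin.lt_def, hik]
  obtain ⟨p⟩ := hG (v j) ⟨v i, by simpa using hij.ne⟩ ⟨v k, by simpa using hjk.ne'⟩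
  obtain ⟨⟨⟨x, y⟩, hxy⟩, -, hx, hy⟩ :=
    p.exists_boundary_dart {z | v.symm z ≤ i} (by simp) (by simpa using hij.trans hjk)
  replace hx : v.symm x ≤ i := hx
  replace hy : i < v.symm y := not_le.1 hy
  have hyj : v.symm y ≠ j := fun h => y.2 (by simp [← h])
  have hadj : G.Adj (v (v.symm x)) (v (v.symm y)) := by simpa using hxy
  exact hv.adj_of_le hx (hij.trans hjk) (by lia) hadj

lemma preconnected_induce_of_subsingleton_compl
    (hadj : ∀ i j : Fin n, i < j → (j : ℕ) ≤ i + 2 → G.Adj (v i) (v j)) {s : Set V}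
    (hs : sᶜ.Subsingleton) : (G.induce s).Preconnected := by
  have hreach (i : Fin n) (hi : v i ∈ s) (j : Fin n) (hij : i ≤ j) (hj : v j ∈ s) :
      (G.induce s).Reachable ⟨v i, hi⟩ ⟨v j, hj⟩ := by
    induction j using WellFoundedLT.induction with
    | ind j ih =>
      rcases hij.eq_or_lt with rfl | hlt
      · rfl
      obtain ⟨k, hik, hkj, hjk, hk⟩ : ∃ k : Fin n, i ≤ k ∧ k < j ∧ (j : ℕ) ≤ k + 2 ∧ v k ∈ s := by
        obtain ⟨p, hp⟩ : ∃ p : Fin n, (p : ℕ) + 1 = j := ⟨⟨j - 1, by omega⟩, by simp only; omega⟩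
        by_cases hps : v p ∈ s
        · exact ⟨p, by lia, by lia, by lia, hps⟩
        have hip : i ≠ p := fun h => hps (h ▸ hi)
        obtain ⟨q, hq⟩ : ∃ q : Fin n, (q : ℕ) + 2 = j := ⟨⟨j - 2, by omega⟩, by simp only; omega⟩
        refine ⟨q, by lia, by lia, by lia, by_contra fun hqs => ?_⟩
        have hpq : p = q := v.injective (hs hps hqs)
        lia
      have hkj' : (G.induce s).Adj ⟨v k, hk⟩ ⟨v j, hj⟩ := hadj k j hkj hjk
      exact (ih k hkj hik hk).trans hkj'.reachable
  rintro ⟨x, hx⟩ ⟨y, hy⟩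
  obtain ⟨i, rfl⟩ := v.surjective x
  obtain ⟨j, rfl⟩ := v.surjective y
  rcases le_total i j with hij | hji
  · exact hreach i hx j hij hy
  · exact (hreach j hy i hji hx).symm

lemma isTwoConnected_of_adj [Fintype V] (hn : 3 ≤ n)
    (hadj : ∀ i j : Fin n, i < j → (j : ℕ) ≤ i + 2 → G.Adj (v i) (v j)) : IsTwoConnected G := by
  have hcard : 3 ≤ Fintype.card V := by rwa [← Fintype.card_congr v, Fintype.card_fin]
  have : Nontrivial V := Fintype.one_lt_card_iff_nontrivial.1 (by omega)
  refine ⟨hcard, G.induceUnivIso.connected_iff.1 ?_, fun x => ?_⟩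
  · exact ⟨preconnected_induce_of_subsingleton_compl hadj (by simp)⟩
  · have : Nonempty ({x}ᶜ : Set V) := (Set.nonempty_compl_of_nontrivial x).to_subtype
    exact ⟨preconnected_induce_of_subsingleton_compl hadj (by simp)⟩

end TwoConnected

section DoubledPath

lemma isUnitIntervalGraph_of_int {V : Type*} {G : SimpleGraph V} {N : ℤ} (hN : 0 < N) (f : V → ℤ)
    (hf : Function.Injective f) (hadj : ∀ x y, x ≠ y → (G.Adj x y ↔ |f x - f y| ≤ N)) :
    IsUnitIntervalGraph G := by
  have hN' : (0 : ℝ) < N := Int.cast_pos.2 hN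
  refine ⟨fun x => f x / N, fun x y hxy => hf ?_, fun x y hxy => ?_⟩
  · exact Int.cast_injective ((div_left_inj' hN'.ne').1 hxy)
  have hle (a b : ℤ) : (a / N : ℝ) ≤ b / N + 1 ↔ a - b ≤ N := by
    rw [← Int.cast_le (R := ℝ), Int.cast_sub, ← sub_le_iff_le_add', ← sub_div, div_le_one hN']
  rw [hadj x y hxy, Set.Icc_inter_Icc, Set.nonempty_Icc, sup_le_iff, le_inf_iff, le_inf_iff,
    abs_sub_le_iff]
  simp only [hle, sub_self, hN.le, true_and, and_true]

lemma maximalCliquesShareTwo_of_forall_exists_twin {V : Type*} [Finite V] {G : SimpleGraph V}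
    (h : ∀ x, ∃ y, G.Adj x y ∧ ∀ z, G.Adj x z → z ≠ y → G.Adj y z) : MaximalCliquesShareTwo G := by
  rintro C D hC hD - ⟨x, hxC, hxD⟩
  obtain ⟨y, hxy, hy⟩ := h x
  have hmem {E : Set V} (hE : Maximal G.IsClique E) (hxE : x ∈ E) : y ∈ E := by
    refine hE.2 (y := insert y E) ?_ (Set.subset_insert y E) (Set.mem_insert y E)
    refine SimpleGraph.isClique_insert.2 ⟨hE.1, fun z hz hyz => ?_⟩
    rcases eq_or_ne x z with rfl | hxz
    · exact hxy.symm
    · exact hy z (hE.1 hxE hz hxz) hyz.symm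
  exact (Set.one_lt_ncard_iff (Set.toFinite _)).2
    ⟨x, y, ⟨hxC, hxD⟩, ⟨hmem hC hxC, hmem hD hxD⟩, hxy.ne⟩

/-- The strong product of a path with `T + 1` vertices and an edge, as a graph on
`{0, …, 2 * T + 1}`: the `i`-th vertex of the path is replaced by `2 * i` and `2 * i + 1`. -/
def doubledPath (T : ℕ) : SimpleGraph (Fin (2 * T + 2)) where
  Adj i j := i ≠ j ∧ (i : ℕ) / 2 ≤ j / 2 + 1 ∧ (j : ℕ) / 2 ≤ i / 2 + 1
  symm := ⟨fun _ _ h => ⟨h.1.symm, h.2.2, h.2.1⟩⟩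
  loopless := ⟨fun _ h => h.1 rfl⟩

namespace doubledPath

variable {T : ℕ} {i j : Fin (2 * T + 2)}

lemma adj_iff : (doubledPath T).Adj i j ↔
    i ≠ j ∧ (i : ℕ) / 2 ≤ j / 2 + 1 ∧ (j : ℕ) / 2 ≤ i / 2 + 1 :=
  Iff.rfl

lemma isUnitIntervalGraph : IsUnitIntervalGraph (doubledPath T) := by
  refine isUnitIntervalGraph_of_int (N := 4) (by norm_num) (fun i => ((i + i / 2 : ℕ) : ℤ))
    (fun i j hij => ?_) fun i j hij => ?_
  · simp only [Nat.cast_inj] at hij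
    omega
  · rw [adj_iff, abs_le]
    omega

lemma isUnitIntervalOrder : IsUnitIntervalOrder (doubledPath T) (Equiv.refl _) := by
  refine fun i => ⟨fun a ha b hb c hc => ?_⟩
  simp only [Equiv.refl_apply, Set.mem_ofPred_eq, adj_iff, Set.mem_Icc] at ha hb hc ⊢
  lia

lemma maximalCliquesShareTwo : MaximalCliquesShareTwo (doubledPath T) := by
  refine maximalCliquesShareTwo_of_forall_exists_twin fun x => ?_
  refine ⟨⟨4 * (x / 2) + 1 - x, by omega⟩, ?_, fun z hxz hz => ?_⟩
  · rw [adj_iff]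
    lia
  · rw [adj_iff] at hxz ⊢
    lia

lemma isTwoConnected (hT : 1 ≤ T) : IsTwoConnected (doubledPath T) := by
  refine isTwoConnected_of_adj (v := Equiv.refl _) (by omega) fun i j hij hji => ?_
  rw [Equiv.refl_apply, Equiv.refl_apply, adj_iff]
  lia

lemma edist_le {k : ℕ} (hk : 1 ≤ k) (hij : (i : ℕ) / 2 ≤ j / 2) (hjk : (j : ℕ) / 2 ≤ i / 2 + k) :
    (doubledPath T).edist i j ≤ k := by
  induction k, hk using Nat.le_induction generalizing j with
  | base =>
    rw [Nat.cast_one, SimpleGraph.edist_le_one_iff_adj_or_eq, adj_iff]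
    lia
  | succ k _ ih =>
    by_cases hle : (j : ℕ) / 2 ≤ i / 2 + k
    · exact (ih hij hle).trans (by norm_cast; omega)
    obtain ⟨l, hl⟩ : ∃ l : Fin (2 * T + 2), (l : ℕ) + 2 = j :=
      ⟨⟨j - 2, by omega⟩, by simp only; omega⟩
    have hlj : (doubledPath T).Adj l j := by
      rw [adj_iff]
      lia
    rw [Nat.cast_succ]
    exact SimpleGraph.edist_triangle.trans (add_le_add (ih (j := l) (by lia) (by lia))
      (SimpleGraph.edist_le_one_iff_adj_or_eq.2 (Or.inl hlj)))

lemma div_two_le_add_length (p : (doubledPath T).Walk i j) : (j : ℕ) / 2 ≤ i / 2 + p.length := by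
  induction p with
  | nil => simp
  | cons h p ih =>
    have := (adj_iff.1 h).2.2
    rw [SimpleGraph.Walk.length_cons]
    omega

lemma diam_eq (hT : 1 ≤ T) : (doubledPath T).diam = T := by
  have hle : (doubledPath T).ediam ≤ T := by
    refine SimpleGraph.ediam_le_of_edist_le fun i j => ?_
    rcases le_total ((i : ℕ) / 2) (j / 2) with hij | hji
    · exact edist_le hT hij (by omega)
    · exact SimpleGraph.edist_comm.trans_le (edist_le hT hji (by omega))
  have hge : (T : ℕ∞) ≤ (doubledPath T).ediam := by
    refine le_trans (le_iInf fun p => ?_)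
      (SimpleGraph.edist_le_ediam (u := ⟨0, by omega⟩) (v := ⟨2 * T, by omega⟩))
    simpa using div_two_le_add_length p
  rw [SimpleGraph.diam, hle.antisymm hge, ENat.toNat_natCast]

lemma mem_percSet_firstTwo {t : ℕ} :
    i ∈ percSet (doubledPath T) (firstTwo (Equiv.refl _)) t ↔ (i : ℕ) / 2 ≤ t := by
  induction t generalizing i with
  | zero =>
    refine (apply_mem_firstTwo (v := Equiv.refl _)).trans ?_
    lia
  | succ t ih =>
    refine (apply_mem_percSet_succ (Equiv.refl _)).trans ?_
    simp only [Equiv.refl_apply, ih, adj_iff]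
    refine ⟨by rintro (h | ⟨j, k, -, ⟨h, hj⟩, -⟩) <;> omega, fun hi => ?_⟩
    rcases hi.lt_or_eq with hlt | heq
    · exact Or.inl (by omega)
    · exact Or.inr ⟨⟨2 * t, by omega⟩, ⟨2 * t + 1, by omega⟩, by simp, by lia, by lia⟩

lemma percSet_firstTwo_eq_univ_iff {t : ℕ} :
    percSet (doubledPath T) (firstTwo (Equiv.refl _)) t = Set.univ ↔ T ≤ t := by
  simp only [Set.eq_univ_iff_forall, mem_percSet_firstTwo]
  refine ⟨fun h => ?_, fun h i => by omega⟩
  simpa using h ⟨2 * T, by omega⟩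

lemma percTime_eq : percTime (doubledPath T) = T := by
  have hull : IsHullSet (doubledPath T) (firstTwo (Equiv.refl _)) :=
    (isHullSet_iff _ _).2 ⟨T, percSet_firstTwo_eq_univ_iff.2 le_rfl⟩
  rw [← isUnitIntervalOrder.percTimeOf_firstTwo hull]
  exact (percTimeOf_le (percSet_firstTwo_eq_univ_iff.2 le_rfl)).antisymm
    (percSet_firstTwo_eq_univ_iff.1 hull.percSet_percTimeOf)

end doubledPath
end DoubledPath
end P3Perc

theorem mainTheorem6_general {V : Type*} [Fintype V] (G : SimpleGraph V)
    (h2 : P3Perc.IsTwoConnected G) :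
    (∃ (m : ℕ) (Gstar : SimpleGraph (Fin m)),
        P3Perc.IsTwoConnected Gstar ∧ P3Perc.IsUnitIntervalGraph Gstar ∧
        P3Perc.MaximalCliquesShareTwo Gstar ∧
        P3Perc.percTime G = P3Perc.percTime Gstar ∧
        P3Perc.percTime Gstar = Gstar.diam) ∧
    (∀ v : Fin (Fintype.card V) ≃ V, P3Perc.IsUnitIntervalOrder G v →
        (P3Perc.IsHullSet G {v ⟨0, by have := h2.1; omega⟩, v ⟨1, by have := h2.1; omega⟩} ∧
          P3Perc.percTimeOf G {v ⟨0, by have := h2.1; omega⟩, v ⟨1, by have := h2.1; omega⟩} =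
            P3Perc.percTime G) ∧
        (P3Perc.IsHullSet G {v ⟨Fintype.card V - 2, by have := h2.1; omega⟩,
            v ⟨Fintype.card V - 1, by have := h2.1; omega⟩} ∧
          P3Perc.percTimeOf G {v ⟨Fintype.card V - 2, by have := h2.1; omega⟩,
            v ⟨Fintype.card V - 1, by have := h2.1; omega⟩} = P3Perc.percTime G)) := by
  obtain ⟨hcard, hconn, hdel⟩ := h2
  constructor
  · obtain ⟨x, hx⟩ := P3Perc.exists_nontrivial_neighborSet hconn (by rwa [Nat.card_eq_fintype_card])
    have hT := P3Perc.one_le_percTime hx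
    refine ⟨_, P3Perc.doubledPath (P3Perc.percTime G), P3Perc.doubledPath.isTwoConnected hT,
      P3Perc.doubledPath.isUnitIntervalGraph, P3Perc.doubledPath.maximalCliquesShareTwo,
      P3Perc.doubledPath.percTime_eq.symm, ?_⟩
    rw [P3Perc.doubledPath.percTime_eq, P3Perc.doubledPath.diam_eq hT]
  · intro v hv
    rw [← P3Perc.firstTwo_eq_pair v (by omega), ← P3Perc.firstTwo_rev_eq_pair v (by omega)]
    have hull : P3Perc.IsHullSet G (P3Perc.firstTwo v) := hv.isHullSet_firstTwo fun i j =>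
      hv.adj_of_preconnected_induce fun x => (hdel x).preconnected
    have hullRev := hv.isHullSet_firstTwo_rev hull
    exact ⟨⟨hull, hv.percTimeOf_firstTwo hull⟩, hullRev, hv.rev.percTimeOf_firstTwo hullRev⟩

theorem mainTheorem6 {V : Type*} [Fintype V] (G : SimpleGraph V)
    (h3 : 3 ≤ Fintype.card V) (h2 : P3Perc.IsTwoConnected G)
    (hG : P3Perc.IsUnitIntervalGraph G) :
    (∃ (m : ℕ) (Gstar : SimpleGraph (Fin m)),
        P3Perc.IsTwoConnected Gstar ∧ P3Perc.IsUnitIntervalGraph Gstar ∧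
        P3Perc.MaximalCliquesShareTwo Gstar ∧
        P3Perc.percTime G = P3Perc.percTime Gstar ∧
        P3Perc.percTime Gstar = Gstar.diam) ∧
    (∀ v : Fin (Fintype.card V) ≃ V, P3Perc.IsUnitIntervalOrder G v →
        (P3Perc.IsHullSet G {v ⟨0, by omega⟩, v ⟨1, by omega⟩} ∧
          P3Perc.percTimeOf G {v ⟨0, by omega⟩, v ⟨1, by omega⟩} = P3Perc.percTime G) ∧
        (P3Perc.IsHullSet G
            {v ⟨Fintype.card V - 2, by omega⟩, v ⟨Fintype.card V - 1, by omega⟩} ∧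
          P3Perc.percTimeOf G
            {v ⟨Fintype.card V - 2, by omega⟩, v ⟨Fintype.card V - 1, by omega⟩} =
              P3Perc.percTime G)) :=
  mainTheorem6_general G h2
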